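/- Let $\Gamma$ be a countable discrete group acting by homeomorphisms on a compact Hausdorff space $X$, and suppose that there is a $\Gamma$-invariant Borel probability measure $\mu$ on $X$. Then the action of $\Gamma$ on $X$ is a-T-menable if and only if $\Gamma$ is a-T-menable. In particular, if $\Gamma$ is not a-T-menable, then no action of $\Gamma$ by homeomorphisms on a compact Hausdorff space that preserves a Borel probability measure is a-T-menable. Here $\Gamma$ is called a-T-menable if it admits a metrically proper, affine isometric action $\alpha$ on a complex Hilbert space $H$, metrically proper meaning that $\|\alpha_s(v)\|\to\infty$ as $s\to\infty$ in $\Gamma$, for every $v\in H$. A function $h\colon X\times\Gamma\to\mathbb{C}$ is positive definite if for all $s_1,\dots,s_n\in\Gamma$ and $x\in X$ the matrix $[h(s_i.x,\,s_is_j^{-1})]_{i,j}$ is positive semidefinite. The action of $\Gamma$ on $X$ is a-T-menable if there is a sequence of positive definite functions $h_n\in C_0(X\times\Gamma)$ (continuous functions vanishing at infinity, $\Gamma$ being discrete) such that $h_n\to1$ uniformly on compact subsets of $X\times\Gamma$. -/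

import Mathlib

open Filter Topology MeasureTheory
open scoped ZeroAtInfty ComplexOrder

universe u v

/-- A function `h : X × Γ → ℂ` is positive definite if, for all `s₁, …, sₙ ∈ Γ` and `x ∈ X`, the
matrix `[h (sᵢ • x, sᵢ * sⱼ⁻¹)]` is positive semidefinite. -/
def IsPositiveDefiniteOn {Γ : Type u} {X : Type v} [Group Γ] [MulAction Γ X]
    (h : X × Γ → ℂ) : Prop :=
  ∀ (n : ℕ) (s : Fin n → Γ) (x : X),
    (Matrix.of fun i j : Fin n => h (s i • x, s i * (s j)⁻¹)).PosSemidef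

/-- An action of a discrete group `Γ` on a space `X` is a-T-menable if there are positive definite
functions `hₙ ∈ C₀(X ⋊ Γ)` converging to `1` uniformly on compact sets. The underlying space of
the transformation groupoid `X ⋊ Γ` is the product `X × Γ`. -/
def IsATMenableAction (Γ : Type u) (X : Type v) [Group Γ] [TopologicalSpace Γ]
    [TopologicalSpace X] [MulAction Γ X] : Prop :=
  ∃ h : ℕ → C₀(X × Γ, ℂ),
    (∀ n, IsPositiveDefiniteOn (h n : X × Γ → ℂ)) ∧
    ∀ K : Set (X × Γ), IsCompact K →
      TendstoUniformlyOn (fun n p => h n p) (fun _ => (1 : ℂ)) atTop K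

/-- A discrete group `Γ` is a-T-menable if it admits a metrically proper, affine isometric action
`α` on a (complex) Hilbert space `H`, where metrically proper means that `‖α s v‖ → ∞` as `s → ∞`
in the discrete group `Γ`, for each `v ∈ H`. -/
def IsATMenableGroup (Γ : Type u) [Group Γ] : Prop :=
  ∃ (H : Type u) (_ : NormedAddCommGroup H) (_ : InnerProductSpace ℂ H) (_ : CompleteSpace H)
    (α : Γ →* (H ≃ᵃⁱ[ℂ] H)),
    ∀ v : H, Tendsto (fun s : Γ => ‖α s v‖) cofinite atTop

/-! From group to action: for a proper affine isometric action `α`, the Gaussians `exp (-c ‖α s 0‖ ^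
2)` are positive definite on Γ and vanish at infinity, and they tend to 1 as `c → 0`. Pulled back
along `X × Γ → Γ`, they stay in C₀ because X is compact.

From action to group: integrating `h n (x, s)` over the invariant probability measure gives positive
definite functions on Γ, vanishing at infinity and tending to 1 pointwise. A sufficiently fast
subsequence `φ k` makes `∑ (φ k s - φ k 1)` converge to a conditionally positive definite function
whose negated real part is proper. A GNS construction on finitely supported functions of sum zero
turns it into a proper cocycle, hence a proper affine action. -/

open scoped ComplexConjugate Matrix

/-- A unitary representation on a semi-inner product space together with a proper cocycle yields a
metrically proper affine isometric action on the completion. -/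
theorem IsATMenableGroup.of_cocycle {Γ : Type u} [Group Γ] {V : Type u}
    [SeminormedAddCommGroup V] [InnerProductSpace ℂ V] (U : Γ →* (V →ₗ[ℂ] V))
    (hU : ∀ g v, ‖U g v‖ = ‖v‖) (b : Γ → V) (hb : ∀ g h, b (g * h) = b g + U g (b h))
    (hproper : Tendsto (fun s => ‖b s‖) cofinite atTop) : IsATMenableGroup Γ := by
  let e : V →ₗ[ℂ] UniformSpace.Completion V :=
    (UniformSpace.Completion.toComplₗᵢ (𝕜 := ℂ) (E := V)).toLinearMap
  have he : DenseRange e := UniformSpace.Completion.denseRange_coe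
  have hne : ∀ v, ‖e v‖ = ‖v‖ := UniformSpace.Completion.norm_coe
  have hUU : ∀ g h v, U g (U h v) = U (g * h) v := fun g h v => by rw [map_mul]; rfl
  let W : Γ → (V ≃ₗ[ℂ] V) := fun g => LinearEquiv.ofLinearMap (U g) (U g⁻¹)
    (by ext v; simp [hUU]) (by ext v; simp [hUU])
  have hW : ∀ g v, ‖e (W g v)‖ = ‖e v‖ := fun g v => by
    rw [hne, hne]; exact hU g v
  let T : Γ → (UniformSpace.Completion V ≃ₗᵢ[ℂ] UniformSpace.Completion V) := fun g =>
    (W g).extendOfIsometry e e he he (hW g)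
  have hT : ∀ g v, T g (e v) = e (U g v) := fun g v =>
    LinearMap.extendOfNorm_eq (f := e ∘ₗ (W g).toLinearMap) he
      ⟨1, fun x => by simpa using (hW g x).le⟩ v
  have hTT : ∀ g h x, T (g * h) x = T g (T h x) := fun g h x => by
    refine he.induction_on (p := fun x => T (g * h) x = T g (T h x)) x
      (isClosed_eq (T _).continuous ((T _).continuous.comp (T _).continuous)) fun v => ?_
    rw [hT, hT, hT, hUU]
  have hT1 : ∀ x, T 1 x = x := fun x => by
    refine he.induction_on (p := fun x => T 1 x = x) x
      (isClosed_eq (T _).continuous continuous_id) fun v => ?_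
    rw [hT, map_one]; rfl
  have hb1 : b 1 = 0 := by simpa using hb 1 1
  let α : Γ →* (UniformSpace.Completion V ≃ᵃⁱ[ℂ] UniformSpace.Completion V) :=
    { toFun := fun g => (T g).toAffineIsometryEquiv.trans (AffineIsometryEquiv.constVAdd ℂ _ (e (b g)))
      map_one' := by
        ext x
        simp [hT1, hb1]
      map_mul' := fun g h => by
        ext x
        simp [hTT, hb, hT, add_assoc] }
  have hα : ∀ g x, α g x = e (b g) + T g x := fun g x => rfl
  refine ⟨UniformSpace.Completion V, inferInstance, inferInstance, inferInstance, α, fun v => ?_⟩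
  -- Since `T s` is isometric, `‖α s v‖ ≥ ‖b s‖ - ‖v‖`.
  refine tendsto_atTop_mono (fun s => ?_) (tendsto_atTop_add_const_right _ (-‖v‖) hproper)
  have := norm_sub_le (α s v) (T s v)
  rw [hα, add_sub_cancel_right, hne, (T s).norm_map, ← hα] at this
  linarith

/-! ### GNS construction for conditionally positive definite functions -/

/-- The sesquilinear form on finitely supported functions given by the kernel `κ (s * t⁻¹)`. -/
noncomputable def translationForm {Γ : Type u} [Group Γ] (κ : Γ → ℂ) (f g : Γ →₀ ℂ) : ℂ :=
  f.sum fun s z => g.sum fun t w => star z * κ (s * t⁻¹) * w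

section translationForm

variable {Γ : Type u} [Group Γ] {κ : Γ → ℂ}

theorem translationForm_add_left (f f' g : Γ →₀ ℂ) :
    translationForm κ (f + f') g = translationForm κ f g + translationForm κ f' g := by
  unfold translationForm
  rw [Finsupp.sum_add_index'] <;> simp [← Finsupp.sum_add, add_mul]

theorem translationForm_smul_left (c : ℂ) (f g : Γ →₀ ℂ) :
    translationForm κ (c • f) g = conj c * translationForm κ f g := by
  unfold translationForm
  rw [Finsupp.sum_smul_index] <;> simp [Finsupp.mul_sum, ← mul_assoc]

theorem conj_translationForm (hκ : ∀ s, κ s⁻¹ = conj (κ s)) (f g : Γ →₀ ℂ) :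
    conj (translationForm κ f g) = translationForm κ g f := by
  unfold translationForm
  rw [Finsupp.sum_comm]
  simp only [map_finsuppSum]
  refine Finsupp.sum_congr fun t _ => Finsupp.sum_congr fun s _ => ?_
  rw [show t * s⁻¹ = (s * t⁻¹)⁻¹ by group, hκ]
  simp [mul_comm, mul_left_comm]

theorem translationForm_mapDomain (g : Γ) (f f' : Γ →₀ ℂ) :
    translationForm κ (f.mapDomain (· * g⁻¹)) (f'.mapDomain (· * g⁻¹)) =
      translationForm κ f f' := by
  unfold translationForm
  simp [Finsupp.sum_mapDomain_index, add_mul, mul_add]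

/-- Serves twice: as the squared norm of the GNS cocycle, and, for positive definite `κ`, as the
inequality `re κ g ≤ re κ 1`. -/
theorem re_translationForm_single_sub_single (hκ : ∀ s, κ s⁻¹ = conj (κ s)) (g : Γ) :
    (translationForm κ (Finsupp.single g⁻¹ 1 - Finsupp.single 1 1)
      (Finsupp.single g⁻¹ 1 - Finsupp.single 1 1)).re = 2 * ((κ 1).re - (κ g).re) := by
  unfold translationForm
  have key : ∀ F : Γ → ℂ → ℂ, (∀ s z w, F s (z - w) = F s z - F s w) →
      (Finsupp.single g⁻¹ (1 : ℂ) - Finsupp.single 1 1).sum F = F g⁻¹ 1 - F 1 1 := fun F hF => by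
    have h0 : ∀ s, F s 0 = 0 := fun s => by simpa using hF s 0 0
    rw [Finsupp.sum_sub_index hF, Finsupp.sum_single_index (h0 _), Finsupp.sum_single_index (h0 _)]
  have key' : ∀ s z, ((Finsupp.single g⁻¹ (1 : ℂ) - Finsupp.single 1 1).sum
      fun t w => star z * κ (s * t⁻¹) * w) = star z * (κ (s * g) - κ s) := fun s z => by
    rw [key _ (fun _ _ _ => by ring)]; simp; ring
  simp only [key']
  rw [key _ (fun _ _ _ => by rw [star_sub]; ring)]
  simp [hκ]
  ring

end translationForm

/-- A group carrying a conditionally positive definite function `κ` with `-re κ` proper is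
a-T-menable. -/
theorem IsATMenableGroup.of_conditionallyPositiveDefinite {Γ : Type u} [Group Γ] (κ : Γ → ℂ)
    (hκ : ∀ s, κ s⁻¹ = conj (κ s))
    (hpos : ∀ f : Γ →₀ ℂ, f.sum (fun _ z => z) = 0 → 0 ≤ (translationForm κ f f).re)
    (hproper : Tendsto (fun s => -(κ s).re) cofinite atTop) : IsATMenableGroup Γ := by
  let S : (Γ →₀ ℂ) →ₗ[ℂ] ℂ := Finsupp.lsum ℂ fun _ => LinearMap.id
  have hS : ∀ f, S f = f.sum fun _ z => z := fun f => rfl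
  let V := LinearMap.ker S
  let core : PreInnerProductSpace.Core ℂ V :=
    { inner := fun f g => translationForm κ f g
      conj_inner_symm := fun f g => conj_translationForm hκ _ _
      re_inner_nonneg := fun f => hpos f f.2
      add_left := fun f f' g => translationForm_add_left _ _ _
      smul_left := fun f g c => translationForm_smul_left _ _ _ }
  let : SeminormedAddCommGroup V := InnerProductSpace.Core.toSeminormedAddCommGroup (𝕜 := ℂ)
  let : InnerProductSpace ℂ V := .ofCore _
  have hnorm : ∀ f : V, ‖f‖ ^ 2 = (translationForm κ f f).re := fun f =>
    norm_sq_eq_re_inner (𝕜 := ℂ) f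
  have hmap : ∀ g f, S (Finsupp.lmapDomain ℂ ℂ (· * g⁻¹) f) = S f := fun g f => by
    simp [hS, Finsupp.lmapDomain_apply, Finsupp.sum_mapDomain_index]
  let U : Γ →* (V →ₗ[ℂ] V) :=
    { toFun := fun g => (Finsupp.lmapDomain ℂ ℂ (· * g⁻¹)).restrict fun f hf => by
        rw [LinearMap.mem_ker] at hf ⊢; rw [hmap, hf]
      map_one' := by
        ext f : 2
        simp only [LinearMap.restrict_apply, inv_one, mul_one]
        exact Finsupp.mapDomain_id
      map_mul' := fun g h => by
        ext f : 2
        simp [LinearMap.restrict_apply, ← Finsupp.mapDomain_comp, Function.comp_def, mul_assoc] }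
  have hUc : ∀ g f, ((U g f : V) : Γ →₀ ℂ) = Finsupp.mapDomain (· * g⁻¹) (f : Γ →₀ ℂ) :=
    fun g f => rfl
  -- Formally the coboundary `U g δ₁ - δ₁`; as `δ₁` does not have sum zero, it need not be a
  -- coboundary in `V`.
  let b : Γ → V := fun g => ⟨Finsupp.single g⁻¹ 1 - Finsupp.single 1 1, by
    rw [LinearMap.mem_ker, map_sub]; simp [S]⟩
  refine IsATMenableGroup.of_cocycle U (fun g f => ?_) b (fun g h => ?_) ?_
  · rw [← sq_eq_sq₀ (norm_nonneg _) (norm_nonneg _), hnorm, hnorm, hUc, translationForm_mapDomain]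
  · ext1
    rw [Submodule.coe_add, hUc]
    simp only [b, ← Finsupp.lmapDomain_apply ℂ ℂ, map_sub]
    simp
  · have hb : ∀ s, ‖b s‖ = √(2 * ((κ 1).re - (κ s).re)) := fun s => by
      rw [← re_translationForm_single_sub_single hκ, ← hnorm (b s), Real.sqrt_sq (norm_nonneg _)]
    simp only [hb]
    refine Real.tendsto_sqrt_atTop.comp (Tendsto.const_mul_atTop two_pos ?_)
    simpa only [sub_eq_add_neg] using tendsto_atTop_add_const_left _ (κ 1).re hproper

/-! ### Gaussian kernels: from the group to the action -/

/-- An entrywise convergent series of positive semidefinite matrices is positive semidefinite. -/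
theorem Matrix.PosSemidef.of_hasSum {ι κ : Type*} {A : κ → Matrix ι ι ℂ} {B : Matrix ι ι ℂ}
    (hA : ∀ k, (A k).PosSemidef) (h : ∀ i j, HasSum (fun k => A k i j) (B i j)) :
    B.PosSemidef := by
  refine ⟨?_, fun x => ?_⟩
  · ext i j
    refine HasSum.unique ?_ (h i j)
    simpa only [(hA _).isHermitian.apply, Matrix.conjTranspose_apply] using (h j i).star
  · exact HasSum.nonneg (fun k => (hA k).2 x) (hasSum_sum fun i _ => hasSum_sum fun j _ =>
      ((h i j).mul_left _).mul_right _)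

/-- The entrywise exponential of a positive semidefinite matrix is positive semidefinite. -/
theorem Matrix.PosSemidef.map_cexp {ι : Type*} {A : Matrix ι ι ℂ} (hA : A.PosSemidef) :
    (A.map Complex.exp).PosSemidef := by
  have hone : (Matrix.of fun _ _ : ι => (1 : ℂ)).PosSemidef := by
    refine ⟨by ext; simp, fun x => ?_⟩
    have : (x.sum fun i xi => x.sum fun j xj => star xi * (Matrix.of fun _ _ : ι => (1 : ℂ)) i j * xj)
        = star (x.sum fun _ z => z) * (x.sum fun _ z => z) := by
      simp [Finsupp.sum, Finset.sum_mul_sum]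
    rw [this]
    exact star_mul_self_nonneg _
  have hpow : ∀ k : ℕ, (A.map (· ^ k)).PosSemidef := fun k => by
    induction k with
    | zero => simpa [Matrix.map, Matrix.of] using hone
    | succ k ih =>
      have : A.map (· ^ (k + 1)) = (A.map (· ^ k)).hadamard A := by
        ext i j
        simp [pow_succ]
      rw [this]
      exact ih.hadamard hA
  refine Matrix.PosSemidef.of_hasSum (A := fun k : ℕ => ((k.factorial : ℂ)⁻¹) • A.map (· ^ k))
    (fun k => (hpow k).smul (by positivity)) fun i j => ?_
  have := NormedSpace.expSeries_div_hasSum_exp (A i j)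
  rw [← Complex.exp_eq_exp_ℂ] at this
  simpa [div_eq_inv_mul] using this

/-- The Gaussian kernel is positive semidefinite. -/
theorem Matrix.posSemidef_exp_neg_norm_sub_sq {ι H : Type*} [Finite ι] [NormedAddCommGroup H]
    [InnerProductSpace ℂ H] (v : ι → H) {c : ℝ} (hc : 0 ≤ c) :
    (Matrix.of fun i j => Complex.exp ((-(c * ‖v i - v j‖ ^ 2) : ℝ))).PosSemidef := by
  have hgram := Matrix.posSemidef_gram ℂ v
  have h := (((hgram.add hgram.transpose).smul (α := ℂ) (a := c) (by exact_mod_cast hc))).map_cexp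
  have hd := (Matrix.posSemidef_gram ℂ fun i => Complex.exp ((-(c * ‖v i‖ ^ 2) : ℝ)))
  -- Expanding the square, the kernel is the exponential of `2c re ⟪v i, v j⟫` times a rank-one Gram
  -- matrix. Adding the transpose of the Gram matrix produces twice the real part.
  have heq : (Matrix.of fun i j => Complex.exp ((-(c * ‖v i - v j‖ ^ 2) : ℝ))) =
      (((c : ℂ) • (Matrix.gram ℂ v + (Matrix.gram ℂ v)ᵀ)).map Complex.exp).hadamard
        (Matrix.gram ℂ fun i => Complex.exp ((-(c * ‖v i‖ ^ 2) : ℝ))) := by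
    ext i j
    have h1 : inner ℂ (v i) (v j) + inner ℂ (v j) (v i) = ((2 * (inner ℂ (v i) (v j)).re : ℝ) : ℂ) := by
      rw [← inner_conj_symm (v j) (v i), Complex.add_conj]
    have h2 := @norm_sub_sq ℂ _ _ _ _ (v i) (v j)
    simp only [RCLike.re_to_complex] at h2
    simp only [Matrix.of_apply, Matrix.hadamard_apply, Matrix.map_apply, Matrix.smul_apply,
      Matrix.add_apply, Matrix.transpose_apply, Matrix.gram_apply, h1, RCLike.inner_apply, smul_eq_mul,
      ← Complex.exp_conj, Complex.conj_ofReal]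
    rw [← Complex.exp_add, ← Complex.exp_add, h2]
    congr 1
    push_cast
    ring
  rw [heq]
  exact h.hadamard hd

/-- An affine isometric action yields positive definite Gaussian functions. -/
theorem posSemidef_exp_neg_norm_sq {Γ : Type u} [Group Γ] {H : Type u} [NormedAddCommGroup H]
    [InnerProductSpace ℂ H] (α : Γ →* (H ≃ᵃⁱ[ℂ] H)) {c : ℝ} (hc : 0 ≤ c) {n : ℕ} (s : Fin n → Γ) :
    (Matrix.of fun i j => Complex.exp ((-(c * ‖α (s i * (s j)⁻¹) 0‖ ^ 2) : ℝ))).PosSemidef := by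
  convert Matrix.posSemidef_exp_neg_norm_sub_sq (fun i => α (s i)⁻¹ 0) hc using 6 with i j
  have h1 : ‖α (s i * (s j)⁻¹) 0‖ = dist (α (s i) (α (s j)⁻¹ 0)) (α (s i) (α (s i)⁻¹ 0)) := by
    rw [map_mul, map_inv, map_inv]
    simp
  rw [h1, AffineIsometryEquiv.dist_map, dist_comm, dist_eq_norm]

theorem IsATMenableGroup.isATMenableAction {Γ : Type u} {X : Type v} [Group Γ]
    [TopologicalSpace Γ] [DiscreteTopology Γ] [TopologicalSpace X] [CompactSpace X] [MulAction Γ X]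
    (h : IsATMenableGroup Γ) : IsATMenableAction Γ X := by
  obtain ⟨H, _, _, _, α, hα⟩ := h
  let c : ℕ → ℝ := fun n => 1 / ((n : ℝ) + 1)
  have hc : ∀ n, 0 < c n := fun n => by positivity
  let φ : ℕ → Γ → ℂ := fun n s => Complex.exp ((-(c n * ‖α s 0‖ ^ 2) : ℝ))
  have hφ0 : ∀ n, Tendsto (φ n) cofinite (𝓝 0) := fun n => by
    have : Tendsto (fun s => Real.exp (-(c n * ‖α s 0‖ ^ 2))) cofinite (𝓝 0) :=
      Real.tendsto_exp_neg_atTop_nhds_zero.comp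
        (Tendsto.const_mul_atTop (hc n) ((tendsto_pow_atTop two_ne_zero).comp (hα 0)))
    simpa [φ, Function.comp_def] using (Complex.continuous_ofReal.tendsto 0).comp this
  have hφ1 : ∀ s, Tendsto (fun n => φ n s) atTop (𝓝 1) := fun s => by
    have h1 : Tendsto (fun n => -(c n * ‖α s 0‖ ^ 2)) atTop (𝓝 0) := by
      simpa [c] using (tendsto_one_div_add_atTop_nhds_zero_nat.mul_const (‖α s 0‖ ^ 2)).neg
    have h2 : Continuous fun t : ℝ => Complex.exp t := by fun_prop
    simpa [φ, Function.comp_def] using (h2.tendsto 0).comp h1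
  refine ⟨fun n => ⟨⟨fun p => φ n p.2, (continuous_of_discreteTopology (f := φ n)).comp continuous_snd⟩, ?_⟩,
    fun n m s x => posSemidef_exp_neg_norm_sq α (hc n).le s, fun K hK => ?_⟩
  · refine (hφ0 n).comp ?_
    -- As X is compact, going to infinity in `X × Γ` means going to infinity in Γ.
    rw [← Filter.cocompact_eq_cofinite, ← Filter.coprod_cocompact, Filter.cocompact_eq_bot,
      Filter.bot_coprod]
    exact tendsto_comap
  · have hfin : (Prod.snd '' K).Finite := (hK.image continuous_snd).finite_of_discrete
    rw [Metric.tendstoUniformlyOn_iff]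
    intro ε hε
    have : ∀ᶠ n in atTop, ∀ s ∈ Prod.snd '' K, dist (φ n s) 1 < ε :=
      (eventually_all_finite hfin).2 fun s _ => Metric.tendsto_nhds.1 (hφ1 s) ε hε
    filter_upwards [this] with n hn p hp
    rw [dist_comm]
    exact hn _ ⟨p, hp, rfl⟩

/-! ### From positive definite C₀ functions to a proper affine action -/

theorem Matrix.posSemidef_of_forall_fin {ι : Type*} {M : Matrix ι ι ℂ}
    (h : ∀ (n : ℕ) (s : Fin n → ι), (M.submatrix s s).PosSemidef) : M.PosSemidef := by
  refine ⟨?_, fun x => ?_⟩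
  · ext i j
    simpa using (h 2 ![i, j]).isHermitian.apply 0 1
  -- A test vector is finitely supported, so only the submatrix on its enumerated support matters.
  · have hx := (h _ ((↑) ∘ x.support.equivFin.symm)).submatrix x.support.equivFin
    have hx' : (M.submatrix ((↑) : x.support → ι) (↑)).PosSemidef := by
      convert hx using 1
      ext i j
      simp
    have hsupp : (x.subtypeDomain (· ∈ x.support)).support = x.support.attach := by
      ext i
      simpa using Finsupp.mem_support_iff.1 i.2
    have := hx'.2 (x.subtypeDomain (· ∈ x.support))
    simp only [Finsupp.sum, hsupp, Finsupp.subtypeDomain_apply, Matrix.submatrix_apply] at this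
    simpa only [Finsupp.sum, ← Finset.sum_attach x.support] using this

/-- A countable group whose constant function `1` is a pointwise limit of positive definite
functions vanishing at infinity is a-T-menable. -/
theorem IsATMenableGroup.of_posSemidef {Γ : Type u} [Group Γ] [Countable Γ] (φ : ℕ → Γ → ℂ)
    (hpos : ∀ n, (Matrix.of fun s t => φ n (s * t⁻¹)).PosSemidef)
    (h0 : ∀ n, Tendsto (φ n) cofinite (𝓝 0)) (h1 : ∀ s, Tendsto (fun n => φ n s) atTop (𝓝 1)) :
    IsATMenableGroup Γ := by
  have hsymm : ∀ n s, φ n s⁻¹ = conj (φ n s) := fun n s => by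
    simpa using ((hpos n).isHermitian.apply 1 s).symm
  have hle : ∀ n s, (φ n s).re ≤ (φ n 1).re := fun n s => by
    have := (Complex.le_def.1
      ((hpos n).2 (Finsupp.single s⁻¹ 1 - Finsupp.single 1 1))).1
    have h2 := re_translationForm_single_sub_single (hsymm n) s
    unfold translationForm at h2
    simp only [Matrix.of_apply, h2, Complex.zero_re] at this
    linarith
  obtain ⟨c, hc⟩ := exists_injective_nat Γ
  -- The two bounds make the k-th difference at most `2⁻ᵏ / 2` once `k ≥ c s`. The point 1 is listed
  -- separately because `c 1` may exceed `k`.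
  have hex : ∀ k : ℕ, ∃ n, (∀ s, c s ≤ k → ‖φ n s - 1‖ < (1 / 2) ^ k / 4) ∧
      ‖φ n 1 - 1‖ < (1 / 2) ^ k / 4 := fun k => by
    have hfin : {s | c s ≤ k}.Finite := (Set.finite_Iic k).preimage hc.injOn
    have hev : ∀ s, ∀ᶠ n in atTop, ‖φ n s - 1‖ < (1 / 2) ^ k / 4 := fun s => by
      simpa [dist_eq_norm] using Metric.tendsto_nhds.1 (h1 s) ((1 / 2) ^ k / 4) (by positivity)
    exact (((eventually_all_finite hfin).2 fun s _ => hev s).and (hev 1)).exists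
  choose N hN hN1 using hex
  -- Subtracting the value at 1 makes every real part nonpositive, and the constant drops out of the
  -- form on sum-zero functions.
  let d : Γ → ℕ → ℂ := fun s k => φ (N k) s - φ (N k) 1
  have hd : ∀ s, Summable (d s) := fun s => by
    refine Summable.of_norm_bounded_eventually_nat
      (summable_geometric_of_lt_one (by norm_num : (0 : ℝ) ≤ 1 / 2) (by norm_num)) ?_
    filter_upwards [eventually_ge_atTop (c s)] with k hk
    have h3 := norm_sub_le (φ (N k) s - 1) (φ (N k) 1 - 1)
    rw [sub_sub_sub_cancel_right] at h3
    have h4 : (0 : ℝ) < (1 / 2) ^ k := by positivity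
    linarith [hN k s hk, hN1 k]
  let κ : Γ → ℂ := fun s => ∑' k, d s k
  have hκsum : ∀ s, HasSum (d s) (κ s) := fun s => (hd s).hasSum
  refine IsATMenableGroup.of_conditionallyPositiveDefinite κ (fun s => ?_) (fun f hf => ?_) ?_
  · have hφ1 : ∀ n, conj (φ n 1) = φ n 1 := fun n => by simpa using (hsymm n 1).symm
    refine (hκsum s⁻¹).unique ?_
    simpa [d, hsymm, hφ1] using Complex.hasSum_conj'.2 (hκsum s)
  · have hform : HasSum (fun k => translationForm (fun s => d s k) f f) (translationForm κ f f) :=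
      hasSum_sum fun s _ => hasSum_sum fun t _ => ((hκsum _).mul_left _).mul_right _
    refine (Complex.le_def.1 (HasSum.nonneg (fun k => ?_) hform)).1
    have hsplit : translationForm (fun s => d s k) f f = translationForm (φ (N k)) f f -
        star (f.sum fun _ z => z) * φ (N k) 1 * (f.sum fun _ z => z) := by
      simp [translationForm, d, Finsupp.sum, mul_sub, sub_mul, Finset.sum_sub_distrib,
        Finset.sum_mul, Finset.mul_sum]
      exact Finset.sum_comm
    rw [hsplit, hf]
    simpa [translationForm] using (hpos (N k)).2 f
  · refine tendsto_atTop.2 fun R => ?_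
    -- Off a finite set, each of the first `M` terms contributes at least `1 - 1/4 - 1/4 = 1/2`, and
    -- the others are nonnegative.
    obtain ⟨M, hM⟩ := exists_nat_gt (2 * R)
    have hev : ∀ᶠ s in cofinite, ∀ k ∈ Finset.range M, ‖φ (N k) s‖ < 1 / 4 :=
      (Filter.eventually_all_finset _).2 fun k _ => by
        simpa [dist_eq_norm] using Metric.tendsto_nhds.1 (h0 (N k)) (1 / 4) (by norm_num)
    filter_upwards [hev] with s hs
    have hre : HasSum (fun k => -(d s k).re) (-(κ s).re) := (Complex.hasSum_re (hκsum s)).neg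
    refine le_trans ?_ (sum_le_hasSum (Finset.range M) (fun k _ => ?_) hre)
    · have hterm : ∀ k ∈ Finset.range M, (1 / 2 : ℝ) ≤ -(d s k).re := fun k hk => by
        have h5 := (Complex.abs_re_le_norm _).trans (hs k hk).le
        have h6 := (Complex.abs_re_le_norm _).trans (hN1 k).le
        have h7 : (1 / 2 : ℝ) ^ k ≤ 1 := pow_le_one₀ (by norm_num) (by norm_num)
        simp only [Complex.sub_re, Complex.one_re] at h6
        have h8 := abs_le.1 h5
        have h9 := abs_le.1 h6
        simp only [d, Complex.sub_re]
        linarith [h8.2, h9.1]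
      have := Finset.card_nsmul_le_sum _ _ _ hterm
      simp only [Finset.card_range, nsmul_eq_mul] at this
      linarith
    · simp only [d, Complex.sub_re]
      linarith [hle (N k) s]

/-! ### Averaging over the invariant measure -/

theorem IsPositiveDefiniteOn.posSemidef {Γ : Type u} {X : Type v} [Group Γ] [MulAction Γ X]
    {h : X × Γ → ℂ} (hh : IsPositiveDefiniteOn h) (x : X) :
    (Matrix.of fun s t : Γ => h (s • x, s * t⁻¹)).PosSemidef :=
  Matrix.posSemidef_of_forall_fin fun n s => hh n s x

theorem ContinuousMap.integrable_of_compactSpace {X : Type*} [TopologicalSpace X] [CompactSpace X]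
    [MeasurableSpace X] [BorelSpace X] (μ : Measure X) [IsFiniteMeasure μ] (f : C(X, ℂ)) :
    Integrable f μ :=
  Integrable.of_bound f.continuous.aestronglyMeasurable ‖f‖
    (Eventually.of_forall f.norm_coe_le_norm)

/-- Averaging a positive definite function on `X × Γ` over an invariant measure. -/
theorem IsPositiveDefiniteOn.integral {Γ : Type u} {X : Type v} [Group Γ] [TopologicalSpace Γ]
    [TopologicalSpace X] [CompactSpace X] [MulAction Γ X] [ContinuousConstSMul Γ X]
    [MeasurableSpace X] [BorelSpace X] (μ : Measure X) [IsFiniteMeasure μ]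
    [SMulInvariantMeasure Γ X μ] {h : C₀(X × Γ, ℂ)} (hh : IsPositiveDefiniteOn (h : X × Γ → ℂ)) :
    (Matrix.of fun s t : Γ => ∫ x, h (x, s * t⁻¹) ∂μ).PosSemidef := by
  -- Invariance is used here: translating by `s` turns the integrand into the matrix that is
  -- positive semidefinite at each `x`.
  have hinv : ∀ s t : Γ, ∫ x, h (x, s * t⁻¹) ∂μ = ∫ x, h (s • x, s * t⁻¹) ∂μ := fun s t =>
    (integral_smul_eq_self (μ := μ) (fun x => h (x, s * t⁻¹))).symm
  have hint : ∀ s t : Γ, Integrable (fun x => h (s • x, s * t⁻¹)) μ := fun s t =>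
    ContinuousMap.integrable_of_compactSpace μ ⟨fun x => h (s • x, s * t⁻¹), by fun_prop⟩
  refine ⟨?_, fun f => ?_⟩
  · ext s t
    simp only [Matrix.conjTranspose_apply, Matrix.of_apply, RCLike.star_def, hinv, ← integral_conj]
    congr 1
    ext x
    exact (hh.posSemidef x).isHermitian.apply s t
  · have : (f.sum fun s z => f.sum fun t w =>
        star z * (Matrix.of fun s t : Γ => ∫ x, h (x, s * t⁻¹) ∂μ) s t * w) =
        ∫ x, f.sum fun s z => f.sum fun t w => star z * h (s • x, s * t⁻¹) * w ∂μ := by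
      simp only [Finsupp.sum, Matrix.of_apply, hinv]
      rw [integral_finsetSum _ fun s _ => integrable_finsetSum _ fun t _ =>
        ((hint s t).const_mul _).mul_const _]
      refine Finset.sum_congr rfl fun s _ => ?_
      rw [integral_finsetSum _ fun t _ => ((hint s t).const_mul _).mul_const _]
      refine Finset.sum_congr rfl fun t _ => ?_
      rw [integral_mul_const, integral_const_mul]
    rw [this]
    exact integral_nonneg fun x => (hh.posSemidef x).2 f

theorem tendsto_integral_section_cofinite {Γ : Type u} {X : Type v} [TopologicalSpace Γ]
    [DiscreteTopology Γ] [TopologicalSpace X] [MeasurableSpace X] (μ : Measure X)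
    [IsProbabilityMeasure μ] (h : C₀(X × Γ, ℂ)) :
    Tendsto (fun s => ∫ x, h (x, s) ∂μ) cofinite (𝓝 0) := by
  refine Metric.tendsto_nhds.2 fun ε hε => ?_
  have hev := Metric.tendsto_nhds.1 h.zero_at_infty' (ε / 2) (half_pos hε)
  obtain ⟨K, hK, hKs⟩ := Filter.mem_cocompact.1 hev
  have hfin : (Prod.snd '' K).Finite := (hK.image continuous_snd).finite_of_discrete
  filter_upwards [hfin.compl_mem_cofinite] with s hs
  have hb : ∀ x, ‖h (x, s)‖ ≤ ε / 2 := fun x => by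
    have : (x, s) ∈ Kᶜ := fun hx => hs ⟨_, hx, rfl⟩
    have h1 : dist (h (x, s)) 0 < ε / 2 := hKs this
    simpa using h1.le
  have := norm_integral_le_of_norm_le_const (μ := μ) (Eventually.of_forall hb)
  simp only [probReal_univ, mul_one] at this
  simpa using this.trans_lt (half_lt_self hε)

theorem tendsto_integral_section_one {Γ : Type u} {X : Type v} [TopologicalSpace Γ]
    [TopologicalSpace X] [CompactSpace X] [MeasurableSpace X] [BorelSpace X] (μ : Measure X)
    [IsProbabilityMeasure μ] {h : ℕ → C₀(X × Γ, ℂ)}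
    (hh : ∀ K : Set (X × Γ), IsCompact K →
      TendstoUniformlyOn (fun n p => h n p) (fun _ => (1 : ℂ)) atTop K) (s : Γ) :
    Tendsto (fun n => ∫ x, h n (x, s) ∂μ) atTop (𝓝 1) := by
  refine Metric.tendsto_nhds.2 fun ε hε => ?_
  filter_upwards [Metric.tendstoUniformlyOn_iff.1
    (hh (Set.univ ×ˢ {s}) (isCompact_univ.prod isCompact_singleton)) (ε / 2) (half_pos hε)]
    with n hn
  have hb : ∀ x, ‖h n (x, s) - 1‖ ≤ ε / 2 := fun x => by
    rw [← dist_eq_norm, dist_comm]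
    exact (hn (x, s) ⟨trivial, rfl⟩).le
  have := norm_integral_le_of_norm_le_const (μ := μ) (Eventually.of_forall hb)
  have hint : Integrable (fun x => h n (x, s)) μ :=
    ContinuousMap.integrable_of_compactSpace μ ⟨fun x => h n (x, s), by fun_prop⟩
  rw [integral_sub hint (integrable_const _)] at this
  simp only [probReal_univ, mul_one, integral_const, one_smul] at this
  rw [dist_eq_norm]
  exact this.trans_lt (half_lt_self hε)

theorem IsATMenableAction.isATMenableGroup {Γ : Type u} {X : Type v} [Group Γ] [Countable Γ]
    [TopologicalSpace Γ] [DiscreteTopology Γ] [TopologicalSpace X] [CompactSpace X]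
    [MulAction Γ X] [MeasurableSpace X] [BorelSpace X] (μ : Measure X) [IsProbabilityMeasure μ]
    [ContinuousConstSMul Γ X] [SMulInvariantMeasure Γ X μ] (hX : IsATMenableAction Γ X) :
    IsATMenableGroup Γ := by
  obtain ⟨h, hpos, hlim⟩ := hX
  exact IsATMenableGroup.of_posSemidef (fun n s => ∫ x, h n (x, s) ∂μ)
    (fun n => (hpos n).integral μ) (fun n => tendsto_integral_section_cofinite μ (h n))
    (tendsto_integral_section_one μ hlim)


theorem mainTheorem8 {Γ : Type u} {X : Type v}
    [Group Γ] [Countable Γ] [TopologicalSpace Γ] [DiscreteTopology Γ]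
    [TopologicalSpace X] [CompactSpace X] [T2Space X]
    [MulAction Γ X] [ContinuousConstSMul Γ X]
    [MeasurableSpace X] [BorelSpace X]
    (μ : Measure X) [IsProbabilityMeasure μ] [SMulInvariantMeasure Γ X μ] :
    (IsATMenableAction Γ X ↔ IsATMenableGroup Γ) ∧
      (¬ IsATMenableGroup Γ → ¬ IsATMenableAction Γ X) := by
  have h : IsATMenableAction Γ X ↔ IsATMenableGroup Γ :=
    ⟨fun hX => hX.isATMenableGroup μ, fun hΓ => hΓ.isATMenableAction⟩
  exact ⟨h, fun hΓ hX => hΓ (h.1 hX)⟩
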